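/- Let $N\ge 3$ be an integer, let $\mu_0=-\frac{(N-2)^2}{4}$, and for $\mu\ge\mu_0$ put $$\tau_+(\mu)=-\frac{N-2}{2}+\sqrt{\mu-\mu_0}.$$ Let $\Omega\subset\mathbb{R}^N$ be a bounded $C^2$ domain containing the origin, let $\mu_0\le\mu_1<0$, $\mu_0\le\mu_2<0$ and $p,q>0$, and consider the Lane--Emden system with inverse-square potentials $$-\Delta u+\frac{\mu_1}{|x|^2}u=v^p,\qquad -\Delta v+\frac{\mu_2}{|x|^2}v=u^q\qquad\text{in }\Omega\setminus\{0\}.$$ A positive supersolution of the system is a pair $(u,v)$ of positive functions on $\Omega\setminus\{0\}$ that are twice (Fréchet) differentiable at every point of $\Omega\setminus\{0\}$ (for instance of class $C^2$) and satisfy $$-\Delta u(x)+\frac{\mu_1}{|x|^2}u(x)\ge v(x)^p\quad\text{and}\quad -\Delta v(x)+\frac{\mu_2}{|x|^2}v(x)\ge u(x)^q\qquad\text{for every }x\in\Omega\setminus\{0\}.$$ No boundary condition on $\partial\Omega$ is imposed. Assume that one of the following holds: (i) $p\ge\dfrac{N+\tau_+(\mu_1)}{-\tau_+(\mu_2)}$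 or $q\ge\dfrac{N+\tau_+(\mu_2)}{-\tau_+(\mu_1)}$; (ii) $\dfrac{2-\tau_+(\mu_2)}{-\tau_+(\mu_1)}<q<\dfrac{N+\tau_+(\mu_2)}{-\tau_+(\mu_1)}$ and $\tau_+(\mu_1)(pq-1)+2p+2<0$; (iii) $\dfrac{2-\tau_+(\mu_1)}{-\tau_+(\mu_2)}<p<\dfrac{N+\tau_+(\mu_1)}{-\tau_+(\mu_2)}$ and $\tau_+(\mu_2)(pq-1)+2q+2<0$. Then the system admits no positive supersolution. -/

import Mathlib

open scoped Laplacian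

/-- The smallest admissible coefficient `μ₀ = -(N-2)²/4` of the Hardy operator. -/
noncomputable def muZero (N : ℕ) : ℝ := -((N : ℝ) - 2) ^ 2 / 4

/-- `τ₊(μ) = -(N-2)/2 + √(μ - μ₀)`, the larger root of `μ - τ (τ + N - 2) = 0` for `μ ≥ μ₀`. -/
noncomputable def tauPlus (N : ℕ) (μ : ℝ) : ℝ :=
  -((N : ℝ) - 2) / 2 + Real.sqrt (μ - muZero N)

/-- The Hardy operator `𝓛_μ u = -Δu + μ |x|⁻² u`, evaluated at the point `x`. -/
noncomputable def hardyOp {N : ℕ} (μ : ℝ) (u : EuclideanSpace ℝ (Fin N) → ℝ)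
    (x : EuclideanSpace ℝ (Fin N)) : ℝ :=
  -(Δ u) x + μ / ‖x‖ ^ 2 * u x

/-- `Ω` is a bounded `C²` domain: open, connected, bounded, and near every boundary point it is the
strict sublevel set of a `C²` function whose differential does not vanish there. -/
structure IsBoundedC2Domain {N : ℕ} (Ω : Set (EuclideanSpace ℝ (Fin N))) : Prop where
  isOpen : IsOpen Ω
  isConnected : IsConnected Ω
  isBounded : Bornology.IsBounded Ω
  boundary : ∀ z ∈ frontier Ω, ∃ (U : Set (EuclideanSpace ℝ (Fin N)))
    (φ : EuclideanSpace ℝ (Fin N) → ℝ), IsOpen U ∧ z ∈ U ∧ ContDiffOn ℝ 2 φ U ∧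
      (∀ y ∈ U, fderiv ℝ φ y ≠ 0) ∧ Ω ∩ U = {y ∈ U | φ y < 0}

/-- `u` is twice differentiable at the point `x` (so that `Δ u x` is the genuine Laplacian). -/
def TwiceDifferentiableAt {N : ℕ} (u : EuclideanSpace ℝ (Fin N) → ℝ)
    (x : EuclideanSpace ℝ (Fin N)) : Prop :=
  (∀ᶠ y in nhds x, DifferentiableAt ℝ u y) ∧ DifferentiableAt ℝ (fderiv ℝ u) x

/-- `(u, v)` is a positive supersolution of the system
`𝓛_{μ₁} u = v ^ p`, `𝓛_{μ₂} v = u ^ q` in `Ω \ {0}`: both functions are positive and twice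
differentiable in `Ω \ {0}`, and the two inequalities hold at every point of `Ω \ {0}`.
The values of `u` and `v` outside `Ω \ {0}` are irrelevant. -/
structure IsPositiveSupersolution {N : ℕ} (Ω : Set (EuclideanSpace ℝ (Fin N)))
    (μ₁ μ₂ p q : ℝ) (u v : EuclideanSpace ℝ (Fin N) → ℝ) : Prop where
  twiceDiff_left : ∀ x ∈ Ω \ {0}, TwiceDifferentiableAt u x
  twiceDiff_right : ∀ x ∈ Ω \ {0}, TwiceDifferentiableAt v x
  pos_left : ∀ x ∈ Ω \ {0}, 0 < u x
  pos_right : ∀ x ∈ Ω \ {0}, 0 < v x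
  ineq_left : ∀ x ∈ Ω \ {0}, v x ^ p ≤ hardyOp μ₁ u x
  ineq_right : ∀ x ∈ Ω \ {0}, u x ^ q ≤ hardyOp μ₂ v x

/-!
Only the behaviour at the origin matters: supersolutions are already ruled out on a small punctured
ball `0 < |x| ≤ e ^ S` with `S ≤ 0`.

In the variable `r = log |x|`, the operator `|x|² 𝓛_μ` acts on radial functions `g (log |x|)` with
constant coefficients, `μ g - g'' - (N - 2) g'`, and its indicial roots are `τ = τ₊(μ)` and
`σ = -(N - 2) - τ ≤ τ`. A comparison principle (`IsHardySupersolution.radial_le`), proved by touching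
`u` from below with a radial function and hence valid for functions that are only twice
differentiable, and explicit radial subsolutions yield three facts about a positive `u`:

* `|x|² 𝓛_μ u ≥ 0` implies `u ≥ c |x| ^ τ` (`IsHardySupersolution.hasExpLowerBound`);
* `|x|² 𝓛_μ u ≥ c |x| ^ a` with `σ < a < τ` implies `u ≥ c' |x| ^ a`
  (`IsHardySupersolution.hasExpLowerBound_of_source`);
* `|x|² 𝓛_μ u ≥ c |x| ^ a` with `a ≤ σ` is impossible (`IsHardySupersolution.false_of_source`).

For the system, `v ≥ c |x| ^ τ₊(μ₂)` makes `v ^ p` a source for `u`, and case (i) says that its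
exponent is in the impossible range (`IsSuperPair.false_of_critical`). In cases (ii) and (iii) the
lower bounds on `u` and `v` improve each other; the exponent of `u` is iterated under
`a ↦ p (q a + 2) + 2`, which tends to `-∞` because `p q > 1` and the first step decreases it
(`IsSuperPair.false_of_bootstrap`), so the impossible range is reached after finitely many steps.
-/

open Filter Topology

/-! ### Second-order condition at a local minimum -/

/-- Necessary second-order condition at a local minimum, for a function that is merely twice
differentiable at the point: its second derivative need not be continuous. -/
lemma fderiv_fderiv_nonneg_of_isLocalMin {E : Type*} [NormedAddCommGroup E] [NormedSpace ℝ E]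
    {f : E → ℝ} {x : E} (hd : ∀ᶠ y in 𝓝 x, DifferentiableAt ℝ f y)
    (hd2 : DifferentiableAt ℝ (fderiv ℝ f) x) (hmin : IsLocalMin f x) (e : E) :
    0 ≤ fderiv ℝ (fderiv ℝ f) x e e := by
  by_contra! hneg
  set g : ℝ → ℝ := fun s => f (x + s • e) with hg
  have hline (s : ℝ) : HasDerivAt (fun s : ℝ => x + s • e) e s := by
    simpa using ((hasDerivAt_id s).smul_const e).const_add x
  have htend : Tendsto (fun s : ℝ => x + s • e) (𝓝 0) (𝓝 x) := by
    simpa using (hline 0).continuousAt.tendsto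
  have hg1 : ∀ᶠ s in 𝓝 (0 : ℝ), HasDerivAt g (fderiv ℝ f (x + s • e) e) s := by
    filter_upwards [htend.eventually hd] with s hs
    exact hs.hasFDerivAt.comp_hasDerivAt s (hline s)
  have hg2 : deriv g =ᶠ[𝓝 0] fun s => fderiv ℝ f (x + s • e) e :=
    hg1.mono fun s hs => hs.deriv
  have hg3 : deriv (deriv g) 0 = fderiv ℝ (fderiv ℝ f) x e e := by
    rw [hg2.deriv_eq]
    have h1 : HasFDerivAt (fderiv ℝ f) (fderiv ℝ (fderiv ℝ f) x) (x + (0 : ℝ) • e) := by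
      rw [zero_smul, add_zero]; exact hd2.hasFDerivAt
    have h2 : HasDerivAt (fun s : ℝ => fderiv ℝ f (x + s • e)) (fderiv ℝ (fderiv ℝ f) x e) 0 :=
      h1.comp_hasDerivAt (f := fun s : ℝ => x + s • e) 0 (hline 0)
    simpa using (h2.clm_apply (hasDerivAt_const (0 : ℝ) e)).deriv
  have hgmin : IsLocalMin g 0 := by
    have := htend.eventually hmin
    simpa [IsLocalMin, IsMinFilter, hg] using this
  have hgmax : IsLocalMax g 0 :=
    isLocalMax_of_deriv_deriv_neg (by rwa [hg3]) hgmin.deriv_eq_zero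
      hg1.self_of_nhds.continuousAt
  -- A point that is both a local minimum and a local maximum: `g` is locally constant there.
  have hconst : g =ᶠ[𝓝 0] fun _ => g 0 := by
    filter_upwards [hgmin, hgmax] with s h1 h2 using le_antisymm h2 h1
  have : deriv (deriv g) 0 = 0 := by
    rw [hconst.deriv.deriv_eq]; simp
  rw [hg3] at this
  exact hneg.ne this

lemma laplacian_eq_sum_fderiv {N : ℕ} (f : EuclideanSpace ℝ (Fin N) → ℝ)
    (x : EuclideanSpace ℝ (Fin N)) :
    (Δ f) x = ∑ i, fderiv ℝ (fderiv ℝ f) x (EuclideanSpace.basisFun (Fin N) ℝ i)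
      (EuclideanSpace.basisFun (Fin N) ℝ i) := by
  rw [InnerProductSpace.laplacian_eq_iteratedFDeriv_orthonormalBasis f
    (EuclideanSpace.basisFun (Fin N) ℝ)]
  simp [iteratedFDeriv_two_apply]

namespace TwiceDifferentiableAt

variable {N : ℕ} {u w : EuclideanSpace ℝ (Fin N) → ℝ} {x : EuclideanSpace ℝ (Fin N)}

lemma fderiv_sub_eventuallyEq (hu : TwiceDifferentiableAt u x) (hw : TwiceDifferentiableAt w x) :
    fderiv ℝ (u - w) =ᶠ[𝓝 x] fderiv ℝ u - fderiv ℝ w := by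
  filter_upwards [hu.1, hw.1] with y hy hy'
  exact fderiv_sub hy hy'

lemma sub (hu : TwiceDifferentiableAt u x) (hw : TwiceDifferentiableAt w x) :
    TwiceDifferentiableAt (u - w) x := by
  refine ⟨?_, ((hu.2.sub hw.2).congr_of_eventuallyEq (hu.fderiv_sub_eventuallyEq hw))⟩
  filter_upwards [hu.1, hw.1] with y hy hy' using hy.sub hy'

/-- If `w` touches `u` from below at `x`, up to an additive constant, then `Δ w x ≤ Δ u x`. -/
lemma laplacian_le_of_isLocalMin_sub (hu : TwiceDifferentiableAt u x)
    (hw : TwiceDifferentiableAt w x) (h : IsLocalMin (u - w) x) : (Δ w) x ≤ (Δ u) x := by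
  rw [laplacian_eq_sum_fderiv, laplacian_eq_sum_fderiv]
  refine Finset.sum_le_sum fun i _ => ?_
  have h1 := fderiv_fderiv_nonneg_of_isLocalMin (hu.sub hw).1 (hu.sub hw).2 h
    (EuclideanSpace.basisFun (Fin N) ℝ i)
  rw [(hu.fderiv_sub_eventuallyEq hw).fderiv_eq, fderiv_sub hu.2 hw.2] at h1
  simpa using h1

end TwiceDifferentiableAt

/-! ### The Laplacian of radial functions -/

section Radial

variable {E : Type*} [NormedAddCommGroup E] [InnerProductSpace ℝ E]

lemma hasFDerivAt_log_norm {x : E} (hx : x ≠ 0) :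
    HasFDerivAt (fun y : E => Real.log ‖y‖) (Real.exp (-2 * Real.log ‖x‖) • innerSL ℝ x) x := by
  have hx' : 0 < ‖x‖ := norm_pos_iff.2 hx
  have h1 : HasFDerivAt (fun y : E => (1 / 2 : ℝ) * Real.log (‖y‖ ^ 2))
      ((1 / 2 : ℝ) • ((‖x‖ ^ 2)⁻¹ • (2 • innerSL ℝ x))) x :=
    (((hasStrictFDerivAt_norm_sq x).hasFDerivAt).log (by positivity)).const_mul _
  have h2 : Real.exp (-2 * Real.log ‖x‖) = (‖x‖ ^ 2)⁻¹ := by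
    rw [mul_comm, ← Real.rpow_def_of_pos hx', Real.rpow_neg hx'.le]; norm_cast
  have h3 : (1 / 2 : ℝ) • ((‖x‖ ^ 2)⁻¹ • (2 • innerSL ℝ x)) =
      Real.exp (-2 * Real.log ‖x‖) • innerSL ℝ x := by
    rw [h2]; ext y; simp; ring
  have h4 : (fun y : E => (1 / 2 : ℝ) * Real.log (‖y‖ ^ 2)) = fun y => Real.log ‖y‖ := by
    ext y; rw [Real.log_pow]; push_cast; ring
  rwa [h3, h4] at h1

lemma hasFDerivAt_comp_log_norm {g : ℝ → ℝ} {g' : ℝ} {x : E}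
    (hx : x ≠ 0) (hg : HasDerivAt g g' (Real.log ‖x‖)) :
    HasFDerivAt (fun y : E => g (Real.log ‖y‖))
      ((g' * Real.exp (-2 * Real.log ‖x‖)) • innerSL ℝ x) x := by
  rw [mul_smul]
  exact hg.comp_hasFDerivAt x (hasFDerivAt_log_norm hx)

lemma fderiv_comp_log_norm_eventuallyEq {g g' : ℝ → ℝ} (hg : ∀ r, HasDerivAt g (g' r) r)
    {x : E} (hx : x ≠ 0) :
    fderiv ℝ (fun y : E => g (Real.log ‖y‖)) =ᶠ[𝓝 x]
      fun y => (g' (Real.log ‖y‖) * Real.exp (-2 * Real.log ‖y‖)) • innerSL ℝ y := by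
  filter_upwards [isOpen_ne.mem_nhds hx] with y hy
  exact (hasFDerivAt_comp_log_norm hy (hg _)).fderiv

variable (E) in
/-- The real inner product as a genuinely bilinear map; in `innerSL ℝ` the first argument is
conjugate-linear, a distinction that is void over `ℝ` but not for instance search. -/
noncomputable def realInnerL : E →L[ℝ] E →L[ℝ] ℝ := innerSL ℝ

lemma realInnerL_apply (x y : E) : realInnerL E x y = inner ℝ x y := rfl

lemma hasFDerivAt_fderiv_comp_log_norm {g g' g'' : ℝ → ℝ} (hg : ∀ r, HasDerivAt g (g' r) r)
    (hg' : ∀ r, HasDerivAt g' (g'' r) r) {x : E} (hx : x ≠ 0) :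
    HasFDerivAt (fderiv ℝ (fun y : E => g (Real.log ‖y‖)))
      ((g' (Real.log ‖x‖) * Real.exp (-2 * Real.log ‖x‖)) •
          realInnerL E +
        (((g'' (Real.log ‖x‖) - 2 * g' (Real.log ‖x‖)) * Real.exp (-2 * Real.log ‖x‖) *
          Real.exp (-2 * Real.log ‖x‖)) • realInnerL _ x).smulRight (realInnerL _ x)) x := by
  have h1 (r : ℝ) : HasDerivAt (fun r => g' r * Real.exp (-2 * r))
      ((g'' r - 2 * g' r) * Real.exp (-2 * r)) r := by
    have h2 : HasDerivAt (fun r : ℝ => Real.exp (-2 * r)) (Real.exp (-2 * r) * (-2)) r := by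
      simpa using ((hasDerivAt_id r).const_mul (-2)).exp
    exact ((hg' r).mul h2).congr_deriv (by ring)
  have h2 := (hasFDerivAt_comp_log_norm hx (h1 _)).smul (realInnerL E).hasFDerivAt
  exact h2.congr_of_eventuallyEq (fderiv_comp_log_norm_eventuallyEq hg hx)

end Radial


section Euclidean

variable {N : ℕ}

lemma twiceDifferentiableAt_comp_log_norm {g g' g'' : ℝ → ℝ} (hg : ∀ r, HasDerivAt g (g' r) r)
    (hg' : ∀ r, HasDerivAt g' (g'' r) r) {x : EuclideanSpace ℝ (Fin N)} (hx : x ≠ 0) :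
    TwiceDifferentiableAt (fun y : EuclideanSpace ℝ (Fin N) => g (Real.log ‖y‖)) x := by
  refine ⟨?_, (hasFDerivAt_fderiv_comp_log_norm hg hg' hx).differentiableAt⟩
  filter_upwards [isOpen_ne.mem_nhds hx] with y hy
  exact (hasFDerivAt_comp_log_norm hy (hg _)).differentiableAt

/-- In the logarithmic variable `r = log |x|`, the Laplacian of a radial function `g (log |x|)` is
the constant-coefficient operator `|x|⁻² (g'' + (N - 2) g')`. -/
lemma laplacian_comp_log_norm {g g' g'' : ℝ → ℝ} (hg : ∀ r, HasDerivAt g (g' r) r)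
    (hg' : ∀ r, HasDerivAt g' (g'' r) r) {x : EuclideanSpace ℝ (Fin N)} (hx : x ≠ 0) :
    (Δ (fun y : EuclideanSpace ℝ (Fin N) => g (Real.log ‖y‖))) x =
      (g'' (Real.log ‖x‖) + (N - 2) * g' (Real.log ‖x‖)) / ‖x‖ ^ 2 := by
  have hx' : 0 < ‖x‖ := norm_pos_iff.2 hx
  have h2 : Real.exp (-2 * Real.log ‖x‖) = (‖x‖ ^ 2)⁻¹ := by
    rw [mul_comm, ← Real.rpow_def_of_pos hx', Real.rpow_neg hx'.le]; norm_cast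
  rw [laplacian_eq_sum_fderiv, (hasFDerivAt_fderiv_comp_log_norm hg hg' hx).fderiv, h2]
  have h3 := (EuclideanSpace.basisFun (Fin N) ℝ).sum_sq_inner_left x
  set a := g' (Real.log ‖x‖)
  set b := g'' (Real.log ‖x‖)
  have h4 (i : Fin N) : ((a * (‖x‖ ^ 2)⁻¹) •
        realInnerL (EuclideanSpace ℝ (Fin N)) +
      (((b - 2 * a) * (‖x‖ ^ 2)⁻¹ * (‖x‖ ^ 2)⁻¹) • realInnerL _ x).smulRight (realInnerL _ x))
        (EuclideanSpace.basisFun (Fin N) ℝ i) (EuclideanSpace.basisFun (Fin N) ℝ i) =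
      a * (‖x‖ ^ 2)⁻¹ + (b - 2 * a) * (‖x‖ ^ 2)⁻¹ * (‖x‖ ^ 2)⁻¹ *
        inner ℝ x (EuclideanSpace.basisFun (Fin N) ℝ i) ^ 2 := by
    simp only [add_apply, smul_apply,
      ContinuousLinearMap.smulRight_apply, realInnerL_apply, smul_eq_mul,
      real_inner_self_eq_norm_sq, OrthonormalBasis.norm_eq_one]
    ring
  rw [Finset.sum_congr rfl fun i _ => h4 i, Finset.sum_add_distrib, Finset.sum_const,
    ← Finset.mul_sum, h3]
  simp only [Finset.card_univ, Fintype.card_fin, nsmul_eq_mul]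
  field_simp
  ring

/-! ### Supersolutions of the Hardy operator: comparison and lower bounds -/

/-- `u` is positive and twice differentiable on the punctured ball `0 < |x| ≤ e ^ S`, and satisfies
`|x|² 𝓛_μ u ≥ f (log |x|)` there. The source is measured after multiplication by `|x|²`, which turns
the Hardy operator on radial functions into a constant-coefficient operator in `r = log |x|`. -/
structure IsHardySupersolution (μ S : ℝ) (f : ℝ → ℝ) (u : EuclideanSpace ℝ (Fin N) → ℝ) :
    Prop where
  twiceDiff : ∀ x ≠ 0, Real.log ‖x‖ ≤ S → TwiceDifferentiableAt u x
  pos : ∀ x ≠ 0, Real.log ‖x‖ ≤ S → 0 < u x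
  le_hardyOp : ∀ x ≠ 0, Real.log ‖x‖ ≤ S → f (Real.log ‖x‖) ≤ ‖x‖ ^ 2 * hardyOp μ u x

/-- `u` is bounded below by a positive multiple of `|x| ^ a` on the punctured ball
`0 < |x| ≤ e ^ S`. The power is written `exp (a log |x|)`. -/
def HasExpLowerBound (S a : ℝ) (u : EuclideanSpace ℝ (Fin N) → ℝ) : Prop :=
  ∃ c > 0, ∀ x ≠ 0, Real.log ‖x‖ ≤ S → c * Real.exp (a * Real.log ‖x‖) ≤ u x

lemma hasDerivAt_exp_mul_affine (a α β r : ℝ) :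
    HasDerivAt (fun r => Real.exp (a * r) * (α + β * r))
      (Real.exp (a * r) * ((a * α + β) + a * β * r)) r := by
  have h1 : HasDerivAt (fun r : ℝ => Real.exp (a * r)) (Real.exp (a * r) * a) r := by
    simpa using ((hasDerivAt_id r).const_mul a).exp
  have h2 : HasDerivAt (fun r : ℝ => α + β * r) β r := by
    simpa using ((hasDerivAt_id r).const_mul β).const_add α
  exact (h1.mul h2).congr_deriv (by ring)

lemma isCompact_annulus (T S : ℝ) :
    IsCompact {x : EuclideanSpace ℝ (Fin N) | x ≠ 0 ∧ Real.log ‖x‖ ∈ Set.Icc T S} := by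
  have h : {x : EuclideanSpace ℝ (Fin N) | x ≠ 0 ∧ Real.log ‖x‖ ∈ Set.Icc T S} =
      Metric.closedBall 0 (Real.exp S) ∩ {x | Real.exp T ≤ ‖x‖} := by
    ext x
    simp only [Set.mem_ofPred_eq, Set.mem_Icc, Set.mem_inter_iff, mem_closedBall_zero_iff]
    constructor
    · rintro ⟨hx, h1, h2⟩
      have hx' := norm_pos_iff.2 hx
      exact ⟨(Real.log_le_iff_le_exp hx').1 h2, (Real.le_log_iff_exp_le hx').1 h1⟩
    · rintro ⟨h1, h2⟩
      have hx' : 0 < ‖x‖ := (Real.exp_pos T).trans_le h2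
      exact ⟨norm_pos_iff.1 hx', (Real.le_log_iff_exp_le hx').2 h2,
        (Real.log_le_iff_le_exp hx').2 h1⟩
  rw [h]
  exact (isCompact_closedBall _ _).inter_right (isClosed_le continuous_const continuous_norm)

namespace IsHardySupersolution

variable {μ S τ : ℝ} {f : ℝ → ℝ} {u : EuclideanSpace ℝ (Fin N) → ℝ}

/-- Comparison principle on the annulus `e ^ T ≤ |x| ≤ e ^ S`: a radial subsolution `g (log |x|)`
that is nonpositive on the inner sphere and at most `u` on the outer one stays below `u`. Here `τ` is
the larger root of the indicial equation `τ² + (N - 2) τ = μ`. Since `μ` may be negative, `𝓛_μ` does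
not satisfy a maximum principle for free; the ratio with a positive strict supersolution is
minimised instead. -/
lemma radial_le (hu : IsHardySupersolution μ S f u)
    (hτ : τ ^ 2 + (N - 2) * τ = μ) (hτ' : 0 ≤ 2 * τ + (N - 2)) {T : ℝ} {g g' g'' : ℝ → ℝ}
    (hg : ∀ r, HasDerivAt g (g' r) r) (hg' : ∀ r, HasDerivAt g' (g'' r) r)
    (hsub : ∀ r ∈ Set.Ioo T S, μ * g r - g'' r - (N - 2) * g' r ≤ f r)
    (hT : g T ≤ 0) (hS : ∀ x ≠ 0, Real.log ‖x‖ = S → g S ≤ u x)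
    {x : EuclideanSpace ℝ (Fin N)} (hx : x ≠ 0) (hxA : Real.log ‖x‖ ∈ Set.Icc T S) :
    g (Real.log ‖x‖) ≤ u x := by
  -- `h (log |x|) = |x| ^ τ (C - |x|)` is a positive strict supersolution on the ball; this holds
  -- also for a double root `τ`, where `|x| ^ τ` alone has no strictness to spare. The vanishing
  -- slopes `0 * r` put it in the form of `hasDerivAt_exp_mul_affine`.
  set C := Real.exp S + 1
  set h : ℝ → ℝ := fun r =>
    Real.exp (τ * r) * (C + 0 * r) - Real.exp ((τ + 1) * r) * (1 + 0 * r) with hh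
  set h' : ℝ → ℝ := fun r => Real.exp (τ * r) * ((τ * C + 0) + τ * 0 * r) -
    Real.exp ((τ + 1) * r) * (((τ + 1) * 1 + 0) + (τ + 1) * 0 * r) with hh'
  set h'' : ℝ → ℝ := fun r =>
    Real.exp (τ * r) * ((τ * (τ * C + 0) + τ * 0) + τ * (τ * 0) * r) -
    Real.exp ((τ + 1) * r) *
      (((τ + 1) * ((τ + 1) * 1 + 0) + (τ + 1) * 0) + (τ + 1) * ((τ + 1) * 0) * r) with hh''
  have dh (r : ℝ) : HasDerivAt h (h' r) r :=
    (hasDerivAt_exp_mul_affine _ _ _ _).sub (hasDerivAt_exp_mul_affine _ _ _ _)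
  have dh' (r : ℝ) : HasDerivAt h' (h'' r) r :=
    (hasDerivAt_exp_mul_affine _ _ _ _).sub (hasDerivAt_exp_mul_affine _ _ _ _)
  have hsuper (r : ℝ) : 0 < μ * h r - h'' r - (N - 2) * h' r := by
    have : μ * h r - h'' r - (N - 2) * h' r =
        (2 * τ + (N - 2) + 1) * Real.exp ((τ + 1) * r) := by
      simp only [hh, hh', hh'', ← hτ]; ring
    rw [this]; positivity
  have hpos (r : ℝ) (hr : r ≤ S) : 0 < h r := by
    have h1 : h r = Real.exp (τ * r) * (C - Real.exp r) := by
      simp only [hh, add_mul, one_mul, Real.exp_add]; ring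
    have h2 : Real.exp r ≤ Real.exp S := Real.exp_le_exp.2 hr
    rw [h1]
    exact mul_pos (Real.exp_pos _) (by simp only [C]; linarith)
  set A := {x : EuclideanSpace ℝ (Fin N) | x ≠ 0 ∧ Real.log ‖x‖ ∈ Set.Icc T S} with hA
  have hlog : ∀ y ∈ A, ContinuousAt (fun y : EuclideanSpace ℝ (Fin N) => Real.log ‖y‖) y :=
    fun y hy => (hasFDerivAt_log_norm hy.1).continuousAt
  have hcont : ContinuousOn (fun y => (u y - g (Real.log ‖y‖)) / h (Real.log ‖y‖)) A := by
    intro y hy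
    refine ContinuousAt.continuousWithinAt (ContinuousAt.div (ContinuousAt.sub ?_ ?_) ?_ ?_)
    · exact (hu.twiceDiff y hy.1 hy.2.2).1.self_of_nhds.continuousAt
    · exact ContinuousAt.comp (hg _).continuousAt (hlog y hy)
    · exact ContinuousAt.comp (dh _).continuousAt (hlog y hy)
    · exact (hpos _ hy.2.2).ne'
  obtain ⟨z, hzA, hzmin⟩ := (isCompact_annulus T S).exists_isMinOn ⟨x, hx, hxA⟩ hcont
  set s := (u z - g (Real.log ‖z‖)) / h (Real.log ‖z‖) with hs
  have hle : ∀ y ∈ A, s * h (Real.log ‖y‖) ≤ u y - g (Real.log ‖y‖) := fun y hy =>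
    (le_div_iff₀ (hpos _ hy.2.2)).1 (hzmin hy)
  rcases le_or_gt 0 s with hs0 | hs0
  · have := hle x ⟨hx, hxA⟩
    have := mul_nonneg hs0 (hpos _ hxA.2).le
    linarith
  exfalso
  have hz0 := hzA.1
  have hzS := hzA.2.2
  -- The radial function `g + s h`, with `s < 0` the minimal ratio, touches `u` from below at `z`.
  have hzeq : u z = g (Real.log ‖z‖) + s * h (Real.log ‖z‖) := by
    rw [hs, div_mul_cancel₀ _ (hpos _ hzS).ne']; ring
  have hzlt : u z < g (Real.log ‖z‖) := by
    have := mul_neg_of_neg_of_pos hs0 (hpos _ hzS)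
    linarith
  have hzT : T < Real.log ‖z‖ := by
    refine hzA.2.1.lt_of_ne fun h => ?_
    have := hu.pos z hz0 hzS
    rw [← h] at hzlt
    linarith
  have hzS' : Real.log ‖z‖ < S := by
    refine hzS.lt_of_ne fun h => ?_
    have := hS z hz0 h
    rw [h] at hzlt
    linarith
  have dw (r : ℝ) : HasDerivAt (fun r => g r + s * h r) (g' r + s * h' r) r :=
    (hg r).add ((dh r).const_mul s)
  have dw' (r : ℝ) : HasDerivAt (fun r => g' r + s * h' r) (g'' r + s * h'' r) r :=
    (hg' r).add ((dh' r).const_mul s)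
  have hmin : IsLocalMin
      (u - fun y : EuclideanSpace ℝ (Fin N) => g (Real.log ‖y‖) + s * h (Real.log ‖y‖)) z := by
    filter_upwards [isOpen_ne.mem_nhds hz0,
      (hlog z hzA).eventually (Ioo_mem_nhds hzT hzS')] with y hy0 hy
    have := hle y ⟨hy0, hy.1.le, hy.2.le⟩
    simp only [Pi.sub_apply]
    linarith
  have hlap := (hu.twiceDiff z hz0 hzS).laplacian_le_of_isLocalMin_sub
    (twiceDifferentiableAt_comp_log_norm dw dw' hz0) hmin
  rw [laplacian_comp_log_norm dw dw' hz0] at hlap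
  have hz' : 0 < ‖z‖ ^ 2 := by have := norm_pos_iff.2 hz0; positivity
  -- At `z` both functions agree, so the comparison of Laplacians contradicts the strict
  -- inequality for `s h`.
  have h1 := hu.le_hardyOp z hz0 hzS
  have h2 := hsub _ ⟨hzT, hzS'⟩
  have h3 := mul_neg_of_neg_of_pos hs0 (hsuper (Real.log ‖z‖))
  rw [div_le_iff₀ hz'] at hlap
  have h4 : ‖z‖ ^ 2 * hardyOp μ u z = μ * u z - (Δ u) z * ‖z‖ ^ 2 := by
    rw [hardyOp]; field_simp; ring
  rw [h4, hzeq] at h1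
  linarith

lemma exists_pos_le_on_sphere (hu : IsHardySupersolution μ S f u) :
    ∃ m > 0, ∀ x ≠ 0, Real.log ‖x‖ = S → m ≤ u x := by
  rcases Set.eq_empty_or_nonempty
    {x : EuclideanSpace ℝ (Fin N) | x ≠ 0 ∧ Real.log ‖x‖ ∈ Set.Icc S S} with he | hne
  · exact ⟨1, one_pos, fun x hx hxS =>
      (Set.eq_empty_iff_forall_notMem.1 he x ⟨hx, hxS.ge, hxS.le⟩).elim⟩
  · obtain ⟨z, hz, hmin⟩ := (isCompact_annulus (N := N) S S).exists_isMinOn hne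
      (f := u) fun y hy =>
        (hu.twiceDiff y hy.1 hy.2.2).1.self_of_nhds.continuousAt.continuousWithinAt
    exact ⟨u z, hu.pos z hz.1 hz.2.2, fun x hx hxS => hmin ⟨hx, hxS.ge, hxS.le⟩⟩

/-- A positive supersolution is at least of the order of `|x| ^ τ`, for the larger indicial root
`τ`. The subsolutions `|x| ^ τ (1 - (S - r) / n)`, which vanish at `r = S - n`, increase to `|x| ^ τ`
as `n → ∞`; they serve simple and double roots alike. -/
lemma hasExpLowerBound (hu : IsHardySupersolution μ S (fun _ => 0) u)
    (hτ : τ ^ 2 + (N - 2) * τ = μ) (hτ' : 0 ≤ 2 * τ + (N - 2)) :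
    HasExpLowerBound S τ u := by
  obtain ⟨m, hm, hmu⟩ := hu.exists_pos_le_on_sphere
  refine ⟨m * Real.exp (-(τ * S)), by positivity, fun x hx hxS => ?_⟩
  set c := m * Real.exp (-(τ * S)) with hc
  have hc0 : 0 < c := by positivity
  set r := Real.log ‖x‖
  have key (n : ℝ) (hn : 0 < n) (hnr : S - n ≤ r) :
      c * (Real.exp (τ * r) * ((1 - S / n) + 1 / n * r)) ≤ u x := by
    refine hu.radial_le hτ hτ' (T := S - n)
      (g := fun r => c * (Real.exp (τ * r) * ((1 - S / n) + 1 / n * r)))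
      (fun r => (hasDerivAt_exp_mul_affine _ _ _ r).const_mul c)
      (fun r => (hasDerivAt_exp_mul_affine _ _ _ r).const_mul c) ?_ ?_ ?_ hx ⟨hnr, hxS⟩
    · intro r _
      have h1 : 0 ≤ c * (1 / n) * (2 * τ + (N - 2)) * Real.exp (τ * r) := by positivity
      rw [← hτ]
      linear_combination h1
    · have : (1 - S / n) + 1 / n * (S - n) = 0 := by field_simp; ring
      simp only [this, mul_zero, le_refl]
    · intro y hy hyS
      refine le_trans (le_of_eq ?_) (hmu y hy hyS)
      have : (1 - S / n) + 1 / n * S = 1 := by field_simp; ring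
      rw [this, mul_one, hc, mul_assoc, ← Real.exp_add]
      simp
  have hlim : Tendsto (fun n : ℝ => c * (Real.exp (τ * r) * ((1 - S / n) + 1 / n * r))) atTop
      (𝓝 (c * (Real.exp (τ * r) * ((1 - 0) + 0 * r)))) :=
    ((((tendsto_const_nhds.div_atTop tendsto_id).const_sub 1).add
      ((tendsto_const_nhds.div_atTop tendsto_id).mul_const r)).const_mul _).const_mul c
  have := le_of_tendsto hlim (b := u x) (by
    filter_upwards [eventually_gt_atTop 0, eventually_ge_atTop (S - r)] with n h1 h2
    exact key n h1 (by linarith))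
  simpa using this

/-- A source `|x| ^ a` (after multiplication by `|x|²`) with `a` strictly between the two indicial
roots forces a lower bound of the order of `|x| ^ a`: compare with `δ |x| ^ a - η |x| ^ σ`, where `σ`
is the smaller root, and let `η → 0`. -/
lemma hasExpLowerBound_of_source {a c : ℝ} (hc : 0 < c)
    (hu : IsHardySupersolution μ S (fun r => c * Real.exp (a * r)) u)
    (hτ : τ ^ 2 + (N - 2) * τ = μ) (ha : a < τ) (ha' : -(N - 2) - τ < a) :
    HasExpLowerBound S a u := by
  obtain ⟨m, hm, hmu⟩ := hu.exists_pos_le_on_sphere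
  set σ : ℝ := -(N - 2) - τ with hσ
  set κ : ℝ := (τ - a) * (a - σ) with hκ
  have hκ0 : 0 < κ := mul_pos (by linarith) (by linarith)
  set δ := min (c / κ) (m * Real.exp (-(a * S))) with hδ
  have hδ0 : 0 < δ := lt_min (by positivity) (by positivity)
  refine ⟨δ, hδ0, fun x hx hxS => ?_⟩
  set r := Real.log ‖x‖
  refine le_of_forall_pos_le_add fun ε hε => ?_
  set η := ε * Real.exp (-(σ * r)) with hη
  have hη0 : 0 < η := by positivity
  -- Below `log (η / δ) / (a - σ)` the singular term `η |x| ^ σ` dominates `δ |x| ^ a`.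
  set T := min r (Real.log (η / δ) / (a - σ)) with hT
  have key : δ * (Real.exp (a * r) * (1 + 0 * r)) -
      η * (Real.exp (σ * r) * (1 + 0 * r)) ≤ u x := by
    refine hu.radial_le hτ (by linarith) (T := T)
      (g := fun r => δ * (Real.exp (a * r) * (1 + 0 * r)) - η * (Real.exp (σ * r) * (1 + 0 * r)))
      (fun r => ((hasDerivAt_exp_mul_affine _ _ _ r).const_mul δ).sub
        ((hasDerivAt_exp_mul_affine _ _ _ r).const_mul η))
      (fun r => ((hasDerivAt_exp_mul_affine _ _ _ r).const_mul δ).sub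
        ((hasDerivAt_exp_mul_affine _ _ _ r).const_mul η)) ?_ ?_ ?_ hx ⟨min_le_left _ _, hxS⟩
    · intro r _
      have h1 : δ * κ ≤ c := (le_div_iff₀ hκ0).1 (min_le_left _ _)
      have h2 := mul_le_mul_of_nonneg_right h1 (Real.exp_pos (a * r)).le
      refine le_trans (le_of_eq ?_) h2
      rw [hκ, ← hτ, hσ]
      ring
    · have h1 : T * (a - σ) ≤ Real.log (η / δ) :=
        (le_div_iff₀ (by linarith)).1 (min_le_right _ _)
      have h2 := (Real.le_log_iff_exp_le (by positivity)).1 h1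
      rw [le_div_iff₀ hδ0] at h2
      have h3 : Real.exp (a * T) = Real.exp (T * (a - σ)) * Real.exp (σ * T) := by
        rw [← Real.exp_add]; ring_nf
      have h4 := mul_le_mul_of_nonneg_right h2 (Real.exp_pos (σ * T)).le
      simp only [h3]
      linarith
    · intro y hy hyS
      refine le_trans ?_ (hmu y hy hyS)
      have h1 : δ * Real.exp (a * S) ≤ m * Real.exp (-(a * S)) * Real.exp (a * S) :=
        mul_le_mul_of_nonneg_right (min_le_right _ _) (Real.exp_pos _).le
      rw [mul_assoc, ← Real.exp_add, neg_add_cancel, Real.exp_zero] at h1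
      have h2 : 0 < η * Real.exp (σ * S) := by positivity
      linarith
  have : η * Real.exp (σ * r) = ε := by
    rw [hη, mul_assoc, ← Real.exp_add]; simp
  linarith

end IsHardySupersolution

/-! ### Nonexistence for a source that is too singular -/

/-- The integrand is negative for `t < -M` and tends to `-∞` as `t → -∞`, so the integral
eventually becomes nonpositive. -/
lemma exists_intervalIntegral_nonpos {κ M S : ℝ} (hκ : 0 ≤ κ) (hM : 0 ≤ M) :
    ∃ T ≤ S - 1, ∫ t in T..S, (t + M) * Real.exp (-(κ * t)) ≤ 0 := by
  have hint (a b : ℝ) : IntervalIntegrable (fun t => (t + M) * Real.exp (-(κ * t)))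
      MeasureTheory.volume a b := Continuous.intervalIntegrable (by fun_prop) a b
  have hpoly (a b : ℝ) : IntervalIntegrable (fun t => t + M)
      MeasureTheory.volume a b := Continuous.intervalIntegrable (by fun_prop) a b
  set I := ∫ t in (-M)..S, (t + M) * Real.exp (-(κ * t))
  set L := max (max 1 (2 * I)) (1 - S - M) with hL
  have hL1 : 1 ≤ L := (le_max_left _ _).trans (le_max_left _ _)
  have hL2 : 2 * I ≤ L := (le_max_right _ _).trans (le_max_left _ _)
  have hL3 : 1 - S - M ≤ L := le_max_right _ _
  refine ⟨-M - L, by linarith, ?_⟩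
  rw [← intervalIntegral.integral_add_adjacent_intervals (hint (-M - L) (-M)) (hint (-M) S)]
  have h1 : ∫ t in (-M - L)..(-M), (t + M) * Real.exp (-(κ * t)) ≤
      ∫ t in (-M - L)..(-M), (t + M) := by
    refine intervalIntegral.integral_mono_on (by linarith) (hint _ _) (hpoly _ _) fun t ht => ?_
    have h2 : 1 ≤ Real.exp (-(κ * t)) := Real.one_le_exp (by nlinarith [ht.2])
    nlinarith [ht.2]
  have h2 : ∫ t in (-M - L)..(-M), (t + M) = -L ^ 2 / 2 := by
    rw [intervalIntegral.integral_add (by simp) (by simp), integral_id,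
      intervalIntegral.integral_const, smul_eq_mul]
    ring
  nlinarith

namespace IsHardySupersolution

variable {μ S τ : ℝ} {f : ℝ → ℝ} {u : EuclideanSpace ℝ (Fin N) → ℝ}

/-- A source `|x| ^ a` (after multiplication by `|x|²`) with `a` at most the smaller indicial root
`-(N - 2) - τ` is too singular for a positive supersolution to exist. -/
lemma false_of_source (hN : N ≠ 0) (hS : S ≤ 0) {a c : ℝ} (hc : 0 < c)
    (hu : IsHardySupersolution μ S (fun r => c * Real.exp (a * r)) u)
    (hτ : τ ^ 2 + (N - 2) * τ = μ) (hτ' : 0 ≤ 2 * τ + (N - 2)) (ha : a ≤ -(N - 2) - τ) :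
    False := by
  set σ : ℝ := -(N - 2) - τ with hσ
  set κ : ℝ := 2 * τ + (N - 2) with hκ
  obtain ⟨x, hx⟩ : ∃ x : EuclideanSpace ℝ (Fin N), ‖x‖ = Real.exp (S - 1) := by
    have : Nonempty (Fin N) := ⟨⟨0, Nat.pos_of_ne_zero hN⟩⟩
    exact exists_norm_eq _ (Real.exp_pos _).le
  have hx0 : x ≠ 0 := norm_pos_iff.1 (hx ▸ Real.exp_pos _)
  have hxlog : Real.log ‖x‖ = S - 1 := by rw [hx, Real.log_exp]
  set d := c * Real.exp (τ * (S - 1)) with hd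
  have hd0 : 0 < d := by positivity
  -- With `κ` the gap between the roots, `g = c e ^ (τ r) ℓ` and `ℓ r = ∫ t in r..S, (t + M) e ^ (-κ t)`
  -- solve the radial equation with right-hand side `c e ^ (σ r)` exactly, for `κ = 0` as well. As
  -- `g` vanishes at `S` and again at some `T`, it lies below `u`; this `M` makes it exceed `u` at `x`.
  set M := 1 - S + (u x + 1) / d with hM
  have hux := hu.pos x hx0 (by linarith)
  have hM0 : 0 ≤ M := by
    have : 0 < (u x + 1) / d := by positivity
    linarith
  obtain ⟨T, hTS, hT⟩ := exists_intervalIntegral_nonpos (S := S) hτ' hM0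
  have hcont : Continuous fun t => (t + M) * Real.exp (-(κ * t)) := by fun_prop
  set ℓ : ℝ → ℝ := fun r => ∫ t in r..S, (t + M) * Real.exp (-(κ * t)) with hℓ
  have dℓ (r : ℝ) : HasDerivAt ℓ (-((r + M) * Real.exp (-(κ * r)))) r :=
    intervalIntegral.integral_hasDerivAt_left (hcont.intervalIntegrable _ _)
      (hcont.stronglyMeasurableAtFilter _ _) hcont.continuousAt
  have dE (r : ℝ) : HasDerivAt (fun r => Real.exp (τ * r)) (τ * Real.exp (τ * r)) r := by
    simpa [mul_comm] using ((hasDerivAt_id r).const_mul τ).exp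
  have hE (r : ℝ) : Real.exp (τ * r) * Real.exp (-(κ * r)) = Real.exp (σ * r) := by
    rw [← Real.exp_add]; congr 1; rw [hκ, hσ]; ring
  have dg (r : ℝ) : HasDerivAt (fun r => c * (Real.exp (τ * r) * ℓ r))
      (c * (τ * (Real.exp (τ * r) * ℓ r) - Real.exp (σ * r) * (M + 1 * r))) r :=
    (((dE r).mul (dℓ r)).const_mul c).congr_deriv (by rw [← hE]; ring)
  have dg' (r : ℝ) : HasDerivAt
      (fun r => c * (τ * (Real.exp (τ * r) * ℓ r) - Real.exp (σ * r) * (M + 1 * r)))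
      (c * (τ * (τ * (Real.exp (τ * r) * ℓ r) - Real.exp (σ * r) * (M + 1 * r)) -
        Real.exp (σ * r) * ((σ * M + 1) + σ * 1 * r))) r :=
    (((((dE r).mul (dℓ r)).congr_deriv (by rw [← hE]; ring)).const_mul τ).sub
      (hasDerivAt_exp_mul_affine σ M 1 r)).const_mul c
  have key := hu.radial_le hτ hτ' (T := T) dg dg' ?_ ?_ ?_ hx0
    ⟨by linarith, by linarith⟩
  · rw [hxlog] at key
    have h1 : M + (S - 1) ≤ ℓ (S - 1) := by
      have h2 : ∫ _t in (S - 1)..S, (M + (S - 1)) ≤ ℓ (S - 1) := by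
        refine intervalIntegral.integral_mono_on (by linarith) (by simp)
          (hcont.intervalIntegrable _ _) fun t ht => ?_
        have h3 : 1 ≤ Real.exp (-(κ * t)) := Real.one_le_exp (by nlinarith [ht.2])
        have h4 : 0 ≤ t + M := by
          have : 0 < (u x + 1) / d := by positivity
          linarith [ht.1]
        nlinarith [ht.1]
      simpa using h2
    have h2 : (u x + 1) / d ≤ ℓ (S - 1) := by linarith
    rw [div_le_iff₀ hd0] at h2
    have h3 : c * (Real.exp (τ * (S - 1)) * ℓ (S - 1)) = ℓ (S - 1) * d := by rw [hd]; ring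
    linarith
  · intro r hr
    have h1 : Real.exp (σ * r) ≤ Real.exp (a * r) :=
      Real.exp_le_exp.2 (mul_le_mul_of_nonpos_right ha (by linarith [hr.2]))
    refine le_trans (le_of_eq ?_) (mul_le_mul_of_nonneg_left h1 hc.le)
    rw [← hτ, hσ]
    ring
  · have : 0 < c * Real.exp (τ * T) := by positivity
    have h2 := mul_nonpos_of_nonneg_of_nonpos this.le hT
    rwa [mul_assoc] at h2
  · intro y hy hyS
    simpa [hℓ] using (hu.pos y hy hyS.le).le

end IsHardySupersolution

/-! ### The system -/

lemma tauPlus_quadratic {μ : ℝ} (hμ : muZero N ≤ μ) :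
    tauPlus N μ ^ 2 + (N - 2) * tauPlus N μ = μ := by
  have h := Real.sq_sqrt (sub_nonneg.2 hμ)
  have h2 : muZero N = -((N : ℝ) - 2) ^ 2 / 4 := rfl
  rw [tauPlus]
  linear_combination h - h2

lemma two_mul_tauPlus_nonneg (N : ℕ) (μ : ℝ) : 0 ≤ 2 * tauPlus N μ + (N - 2) := by
  have := Real.sqrt_nonneg (μ - muZero N)
  rw [tauPlus]; linarith

lemma tauPlus_neg (hN : 2 < N) {μ : ℝ} (hμ' : μ < 0) : tauPlus N μ < 0 := by
  have hN' : (2 : ℝ) < N := by exact_mod_cast hN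
  have : √(μ - muZero N) < (N - 2) / 2 := by
    rw [Real.sqrt_lt' (by linarith), muZero]
    linarith
  rw [tauPlus]; linarith

/-- A positive supersolution of the Lane–Emden system on the punctured ball `0 < |x| ≤ e ^ S`, in
the logarithmic normalisation of `IsHardySupersolution`. -/
structure IsSuperPair (S μ₁ μ₂ p q : ℝ) (u v : EuclideanSpace ℝ (Fin N) → ℝ) : Prop where
  left : IsHardySupersolution μ₁ S (fun _ => 0) u
  right : IsHardySupersolution μ₂ S (fun _ => 0) v
  ineq_left : ∀ x ≠ 0, Real.log ‖x‖ ≤ S → v x ^ p ≤ hardyOp μ₁ u x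
  ineq_right : ∀ x ≠ 0, Real.log ‖x‖ ≤ S → u x ^ q ≤ hardyOp μ₂ v x

namespace IsSuperPair

variable {S μ₁ μ₂ p q : ℝ} {u v : EuclideanSpace ℝ (Fin N) → ℝ}

lemma symm (h : IsSuperPair S μ₁ μ₂ p q u v) : IsSuperPair S μ₂ μ₁ q p v u :=
  ⟨h.right, h.left, h.ineq_right, h.ineq_left⟩

/-- A lower bound `|x| ^ b` on `v` is a source `|x| ^ (p b + 2)` in the equation for `u`, after
multiplication by `|x|²`. -/
lemma exists_source (h : IsSuperPair S μ₁ μ₂ p q u v) (hp : 0 < p) {b : ℝ}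
    (hv : HasExpLowerBound S b v) :
    ∃ c > 0, IsHardySupersolution μ₁ S (fun r => c * Real.exp ((p * b + 2) * r)) u := by
  obtain ⟨c, hc, hcv⟩ := hv
  refine ⟨c ^ p, by positivity, h.left.twiceDiff, h.left.pos, fun x hx hxS => ?_⟩
  have hx' := norm_pos_iff.2 hx
  have h1 : (c * Real.exp (b * Real.log ‖x‖)) ^ p ≤ hardyOp μ₁ u x :=
    (Real.rpow_le_rpow (by positivity) (hcv x hx hxS) hp.le).trans (h.ineq_left x hx hxS)
  have h2 := mul_le_mul_of_nonneg_left h1 (sq_nonneg ‖x‖)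
  refine le_trans (le_of_eq ?_) h2
  rw [Real.mul_rpow hc.le (Real.exp_pos _).le, ← Real.exp_mul]
  have h3 : ‖x‖ ^ 2 = Real.exp (2 * Real.log ‖x‖) := by
    rw [mul_comm, ← Real.rpow_def_of_pos hx']; norm_cast
  have h4 : (p * b + 2) * Real.log ‖x‖ = 2 * Real.log ‖x‖ + b * Real.log ‖x‖ * p := by ring
  rw [h4, Real.exp_add, h3]
  ring

lemma false_of_expLowerBound (hN : 2 < N) (hS : S ≤ 0) (hμ₁ : muZero N ≤ μ₁)
    (h : IsSuperPair S μ₁ μ₂ p q u v) (hp : 0 < p) {b : ℝ} (hv : HasExpLowerBound S b v)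
    (hb : p * b + 2 ≤ -(N - 2) - tauPlus N μ₁) : False := by
  obtain ⟨c, hc, hu⟩ := h.exists_source hp hv
  exact hu.false_of_source (by omega) hS hc (tauPlus_quadratic hμ₁)
    (two_mul_tauPlus_nonneg N μ₁) hb

/-- Lower bounds pass from `v` to `u` through the first inequality. The new exponent automatically
exceeds the smaller indicial root, since there is no supersolution otherwise. -/
lemma transfer (hN : 2 < N) (hS : S ≤ 0) (hμ₁ : muZero N ≤ μ₁)
    (h : IsSuperPair S μ₁ μ₂ p q u v) (hp : 0 < p) {b : ℝ} (hv : HasExpLowerBound S b v)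
    (hb : p * b + 2 < tauPlus N μ₁) : HasExpLowerBound S (p * b + 2) u := by
  obtain ⟨c, hc, hu⟩ := h.exists_source hp hv
  refine hu.hasExpLowerBound_of_source hc (tauPlus_quadratic hμ₁) hb ?_
  by_contra! hle
  exact h.false_of_expLowerBound hN hS hμ₁ hp hv hle

lemma hasExpLowerBound_tauPlus (hμ₁ : muZero N ≤ μ₁) (h : IsSuperPair S μ₁ μ₂ p q u v) :
    HasExpLowerBound S (tauPlus N μ₁) u :=
  h.left.hasExpLowerBound (tauPlus_quadratic hμ₁) (two_mul_tauPlus_nonneg N μ₁)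

lemma false_of_critical (hN : 2 < N) (hS : S ≤ 0) (hμ₁ : muZero N ≤ μ₁) (hμ₂ : muZero N ≤ μ₂)
    (hμ₂' : μ₂ < 0) (h : IsSuperPair S μ₁ μ₂ p q u v) (hp : 0 < p)
    (hcrit : (N + tauPlus N μ₁) / (-tauPlus N μ₂) ≤ p) : False := by
  have hτ := tauPlus_neg hN hμ₂'
  rw [div_le_iff₀ (by linarith)] at hcrit
  exact h.false_of_expLowerBound hN hS hμ₁ hp (h.symm.hasExpLowerBound_tauPlus hμ₂) (by linarith)

/-- One round trip `u → v → u` maps an exponent `a` to `p (q a + 2) + 2`. The hypotheses make this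
a strict decrease at `τ₊(μ₁)` and force `p q > 1`, so the exponents drop below `τ₊(μ₁) - n d` after
`n` rounds and eventually reach the nonexistence range. -/
lemma false_of_bootstrap (hN : 2 < N) (hS : S ≤ 0) (hμ₁ : muZero N ≤ μ₁) (hμ₁' : μ₁ < 0)
    (hμ₂ : muZero N ≤ μ₂) (h : IsSuperPair S μ₁ μ₂ p q u v) (hp : 0 < p) (hq : 0 < q)
    (hq' : (2 - tauPlus N μ₂) / (-tauPlus N μ₁) < q)
    (hpq : tauPlus N μ₁ * (p * q - 1) + 2 * p + 2 < 0) : False := by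
  have hτ := tauPlus_neg hN hμ₁'
  rw [div_lt_iff₀ (by linarith)] at hq'
  set τ := tauPlus N μ₁
  have hpq1 : 1 < p * q := by
    by_contra! hle
    nlinarith [mul_nonneg_of_nonpos_of_nonpos hτ.le (sub_nonpos.2 hle)]
  set d := -(τ * (p * q - 1) + 2 * p + 2) with hd
  have step {a : ℝ} (ha : a ≤ τ) (hu : HasExpLowerBound S a u) :
      HasExpLowerBound S (p * (q * a + 2) + 2) u := by
    have h1 : q * a ≤ q * τ := mul_le_mul_of_nonneg_left ha hq.le
    have h2 := mul_le_mul_of_nonneg_left h1 hp.le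
    have hv := h.symm.transfer hN hS hμ₂ hq hu (by linarith)
    exact h.transfer hN hS hμ₁ hp hv (by linarith)
  have iter (n : ℕ) : ∃ a ≤ τ - n * d, HasExpLowerBound S a u := by
    induction n with
    | zero => exact ⟨τ, by simp, h.hasExpLowerBound_tauPlus hμ₁⟩
    | succ n ih =>
      obtain ⟨a, ha, hu⟩ := ih
      have hnd : 0 ≤ n * d := mul_nonneg n.cast_nonneg (by linarith)
      refine ⟨_, ?_, step (by linarith) hu⟩
      have h1 : p * q * a ≤ p * q * (τ - n * d) := mul_le_mul_of_nonneg_left ha (by positivity)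
      have h2 : n * d ≤ p * q * (n * d) := le_mul_of_one_le_left hnd hpq1.le
      push_cast
      linarith
  obtain ⟨n, hn⟩ := exists_nat_ge (((N - 2 + tauPlus N μ₂ + 2) / q + τ) / d)
  rw [div_le_iff₀ (by linarith)] at hn
  obtain ⟨a, ha, hu⟩ := iter n
  refine h.symm.false_of_expLowerBound hN hS hμ₂ hq hu ?_
  have h1 : (N - 2 + tauPlus N μ₂ + 2) / q ≤ -a := by linarith
  rw [div_le_iff₀ hq] at h1
  linarith

end IsSuperPair

/-- Only a small ball around the origin matters; its radius is at most `1`, so that `log |x| ≤ 0`. -/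
lemma IsPositiveSupersolution.exists_isSuperPair {Ω : Set (EuclideanSpace ℝ (Fin N))}
    (hΩ : IsOpen Ω) (h0 : (0 : EuclideanSpace ℝ (Fin N)) ∈ Ω) {μ₁ μ₂ p q : ℝ}
    {u v : EuclideanSpace ℝ (Fin N) → ℝ} (h : IsPositiveSupersolution Ω μ₁ μ₂ p q u v) :
    ∃ S ≤ 0, IsSuperPair S μ₁ μ₂ p q u v := by
  obtain ⟨ε, hε, hball⟩ := Metric.isOpen_iff.1 hΩ 0 h0
  refine ⟨min 0 (Real.log (ε / 2)), min_le_left _ _, ?_⟩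
  have hmem (x : EuclideanSpace ℝ (Fin N)) (hx : x ≠ 0)
      (hxS : Real.log ‖x‖ ≤ min 0 (Real.log (ε / 2))) : x ∈ Ω \ {0} := by
    refine ⟨hball ?_, hx⟩
    have := (Real.log_le_log_iff (norm_pos_iff.2 hx) (by positivity)).1
      (hxS.trans (min_le_right _ _))
    rw [mem_ball_zero_iff]
    linarith
  refine ⟨⟨fun x hx hxS => h.twiceDiff_left x (hmem x hx hxS),
      fun x hx hxS => h.pos_left x (hmem x hx hxS), fun x hx hxS => ?_⟩,
    ⟨fun x hx hxS => h.twiceDiff_right x (hmem x hx hxS),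
      fun x hx hxS => h.pos_right x (hmem x hx hxS), fun x hx hxS => ?_⟩,
    fun x hx hxS => h.ineq_left x (hmem x hx hxS), fun x hx hxS => h.ineq_right x (hmem x hx hxS)⟩
  · have h1 := (Real.rpow_pos_of_pos (h.pos_right x (hmem x hx hxS)) p).le.trans
      (h.ineq_left x (hmem x hx hxS))
    positivity
  · have h1 := (Real.rpow_pos_of_pos (h.pos_left x (hmem x hx hxS)) q).le.trans
      (h.ineq_right x (hmem x hx hxS))
    positivity

end Euclidean

theorem theorem2 (N : ℕ) (hN : 3 ≤ N) (Ω : Set (EuclideanSpace ℝ (Fin N)))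
    (hΩ : IsBoundedC2Domain Ω) (h0 : (0 : EuclideanSpace ℝ (Fin N)) ∈ Ω)
    (μ₁ μ₂ p q : ℝ)
    (hμ₁ : muZero N ≤ μ₁) (hμ₁' : μ₁ < 0) (hμ₂ : muZero N ≤ μ₂) (hμ₂' : μ₂ < 0)
    (hp : 0 < p) (hq : 0 < q)
    (h :
      -- case (i)
      ((N + tauPlus N μ₁) / (-tauPlus N μ₂) ≤ p ∨ (N + tauPlus N μ₂) / (-tauPlus N μ₁) ≤ q) ∨
      -- case (ii)
      ((2 - tauPlus N μ₂) / (-tauPlus N μ₁) < q ∧ q < (N + tauPlus N μ₂) / (-tauPlus N μ₁) ∧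
        tauPlus N μ₁ * (p * q - 1) + 2 * p + 2 < 0) ∨
      -- case (iii)
      ((2 - tauPlus N μ₁) / (-tauPlus N μ₂) < p ∧ p < (N + tauPlus N μ₁) / (-tauPlus N μ₂) ∧
        tauPlus N μ₂ * (p * q - 1) + 2 * q + 2 < 0)) :
    ¬ ∃ u v : EuclideanSpace ℝ (Fin N) → ℝ, IsPositiveSupersolution Ω μ₁ μ₂ p q u v := by
  rintro ⟨u, v, huv⟩
  obtain ⟨S, hS, H⟩ := huv.exists_isSuperPair hΩ.isOpen h0
  rcases h with (hp' | hq') | ⟨hq', -, hpq⟩ | ⟨hp', -, hpq⟩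
  · exact H.false_of_critical hN hS hμ₁ hμ₂ hμ₂' hp hp'
  · exact H.symm.false_of_critical hN hS hμ₂ hμ₁ hμ₁' hq hq'
  · exact H.false_of_bootstrap hN hS hμ₁ hμ₁' hμ₂ hp hq hq' hpq
  · exact H.symm.false_of_bootstrap hN hS hμ₂ hμ₂' hμ₁ hq hp hp' (by rwa [mul_comm q p])
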